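/- All vector spaces are over a field $K$ of characteristic zero; in an exponent a homogeneous element stands for its degree. For homogeneous $v_1,\dots,v_n$ and $\sigma\in\mathbb S_n$ the Koszul sign $\varepsilon(\sigma)$ is defined by $v_1\odot\cdots\odot v_n=\varepsilon(\sigma)\,v_{\sigma(1)}\odot\cdots\odot v_{\sigma(n)}$ in the graded symmetric algebra, and $\mathbb S_{(i_1,\dots,i_r)}$ denotes the set of $(i_1,\dots,i_r)$-shuffles. A symmetric graded Lie algebra (sgLa) is a $\mathbb Z$-graded vector space $\mathfrak g$ with a bilinear bracket of degree $1$ such that, for homogeneous $x,y,z$, $[x,y]=(-1)^{xy}[y,x]$ and $[x,[y,z]]=(-1)^{x+1}[[x,y],z]+(-1)^{(x+1)(y+1)}[y,[x,z]]$. A derivation of degree $n$ of an sgLa $\mathfrak h$ is a degree $n$ linear map $D$ with $D[x,y]=(-1)^n[Dx,y]+(-1)^{n(x+1)}[x,Dy]$; $\mathrm{Der}(\mathfrak h)=\bigoplus_n\mathrm{Der}^n(\mathfrak h)$. An action of an sgLa $\mathfrak g$ on an sgLa $\mathfrak h$ is a linear map $\rho:\mathfrak g\to\mathrm{Der}(\mathfrak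 h)$ of degree $1$ with $\rho([x,y]_{\mathfrak g})=(-1)^{x+1}\big(\rho(x)\rho(y)-(-1)^{(x+1)(y+1)}\rho(y)\rho(x)\big)$ for homogeneous $x,y$. A homotopy $\mathcal O$-operator of weight $\lambda$ on $\mathfrak g$ with respect to $\rho$ is a degree $0$ linear map $T=\sum_{i\ge0}T_i:S(\mathfrak h)\to\mathfrak g$, $T_i:S^i(\mathfrak h)\to\mathfrak g$, such that for all $p\ge0$ and homogeneous $v_1,\dots,v_p\in\mathfrak h$ $$\sum_{1\le i<j\le p}(-1)^{\gamma_{ij}}T_{p-1}(\lambda[v_i,v_j]_{\mathfrak h},v_1,\dots,\hat v_i,\dots,\hat v_j,\dots,v_p)+\sum_{l=0}^{p-1}\ \sum_{\sigma\in\mathbb S_{(l,1,p-l-1)}}\varepsilon(\sigma)\,T_{p-l}\big(\rho(T_l(v_{\sigma(1)},\dots,v_{\sigma(l)}))v_{\sigma(l+1)},v_{\sigma(l+2)},\dots,v_{\sigma(p)}\big)$$ $$=\frac12\sum_{l=0}^{p}\ \sum_{\sigma\in\mathbb S_{(l,p-l)}}\varepsilon(\sigma)\,[T_l(v_{\sigma(1)},\dots,v_{\sigma(l)}),T_{p-l}(v_{\sigma(l+1)},\dots,v_{\sigma(p)})]_{\mathfrak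 g},$$ where $\gamma_{ij}=v_i(v_1+\cdots+v_{i-1})+v_j(v_1+\cdots+v_{j-1})+v_iv_j$. An operator homotopy post-Lie algebra is an sgLa $\mathfrak h$ with linear maps $\theta_k:\otimes^k\mathfrak h\to\mathfrak h$ ($k\ge1$) of degree $1$ such that for all $n\ge1$ and homogeneous $v_1,\dots,v_{n+1}\in\mathfrak h$: (i) $\theta_n(v_{\sigma(1)},\dots,v_{\sigma(n-1)},v_n)=\varepsilon(\sigma)\theta_n(v_1,\dots,v_{n-1},v_n)$ for all $\sigma\in\mathbb S_{n-1}$; (ii) $\theta_n(v_1,\dots,v_{n-1},[v_n,v_{n+1}])=(-1)^{v_1+\cdots+v_{n-1}+1}[\theta_n(v_1,\dots,v_n),v_{n+1}]+(-1)^{(v_1+\cdots+v_{n-1}+1)(v_n+1)}[v_n,\theta_n(v_1,\dots,v_{n-1},v_{n+1})]$; (iii) $$\sum_{\substack{i+j=n+1\\ i\ge1,\,j\ge2}}\ \sum_{\sigma\in\mathbb S_{(i-1,1,j-2)}}\varepsilon(\sigma)\,\theta_j\big(\theta_i(v_{\sigma(1)},\dots,v_{\sigma(i)}),v_{\sigma(i+1)},\dots,v_{\sigma(n-1)},v_n\big)$$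 $$+\sum_{\substack{i+j=n+1\\ i,j\ge1}}\ \sum_{\sigma\in\mathbb S_{(j-1,i-1)}}(-1)^{v_{\sigma(1)}+\cdots+v_{\sigma(j-1)}}\varepsilon(\sigma)\,\theta_j\big(v_{\sigma(1)},\dots,v_{\sigma(j-1)},\theta_i(v_{\sigma(j)},\dots,v_{\sigma(n-1)},v_n)\big)$$ $$=\sum_{1\le i<j\le n-1}(-1)^{\gamma_{ij}+1}\theta_{n-1}([v_i,v_j],v_1,\dots,\hat v_i,\dots,\hat v_j,\dots,v_n).$$ **Theorem.** Let $\rho:\mathfrak g\to\mathrm{Der}(\mathfrak h)$ be an action of an sgLa $\mathfrak g$ on an sgLa $\mathfrak h$, and let $T=\sum_{i\ge0}T_i\in\mathrm{Hom}^0(S(\mathfrak h),\mathfrak g)$ be a homotopy $\mathcal O$-operator of weight $1$ on $\mathfrak g$ with respect to $\rho$. Then $(\mathfrak h,[\cdot,\cdot]_{\mathfrak h},\{\theta_k\}_{k\ge1})$ is an operator homotopy post-Lie algebra, where the degree $1$ linear maps $\theta_k:\otimes^k\mathfrak h\to\mathfrak h$ are defined by $$\theta_k(v_1,\dots,v_k)=\rho\big(T_{k-1}(v_1,\dots,v_{k-1})\big)v_k,\qquad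 v_1,\dots,v_k\in\mathfrak h.$$ -/

import Mathlib

namespace HomotopyPostLie

section Combinatorics

/-- The Koszul sign `ε(σ; v₁, …, vₙ)` for homogeneous elements `v i` of degree `d i`, i.e. the sign with
`v₁ ⊙ ⋯ ⊙ vₙ = ε(σ) v_{σ(1)} ⊙ ⋯ ⊙ v_{σ(n)}`: the product of `(-1)^{v_{σ(i)} v_{σ(j)}}` over the
inversions of `σ`. -/
def koszulSign (K : Type*) [Field K] {n : ℕ} (d : Fin n → ℤ) (σ : Equiv.Perm (Fin n)) : K :=
  ∏ i : Fin n, ∏ j : Fin n,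
    if i < j ∧ σ j < σ i then (-1 : K) ^ (d (σ i) * d (σ j)) else 1

/-- The `(l, n - l)`-shuffles in the symmetric group on `n` letters. -/
def shuffles₂ (n l : ℕ) : Finset (Equiv.Perm (Fin n)) :=
  Finset.univ.filter fun σ =>
    ∀ i j : Fin n, i < j → (j.val < l ∨ l ≤ i.val) → σ i < σ j

/-- The `(l, 1, n - l - 1)`-shuffles in the symmetric group on `n` letters (used for `l < n`). The
letters are numbered from `0`, so the middle block is the position `l`. -/
def shuffles₃ (n l : ℕ) : Finset (Equiv.Perm (Fin n)) :=
  Finset.univ.filter fun σ =>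
    ∀ i j : Fin n, i < j → (j.val < l ∨ l < i.val) → σ i < σ j

/-- The pairs `i < j` of positions among `p` letters. -/
def orderedPairs (p : ℕ) : Finset (Fin p × Fin p) :=
  Finset.univ.filter fun q => q.1 < q.2

/-- For `i < j`, the list `(x, v₁, …, v̂ᵢ, …, v̂ⱼ, …, v_p)` has length `p - 1`; for `1 ≤ m`,
`hatIndex i j m` is the index of the `v` standing at position `m` (all positions from `0`). -/
def hatIndex {p : ℕ} (i j : Fin p) (m : Fin (p - 1)) : Fin p :=
  if m.val ≤ i.val then ⟨m.val - 1, by omega⟩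
  else if m.val < j.val then ⟨m.val, by omega⟩
  else ⟨m.val + 1, by omega⟩

/-- `(v_{σ(1)}, …, v_{σ(l)})`. -/
def firstArgs {V : Type*} {p : ℕ} (v : Fin p → V) (σ : Equiv.Perm (Fin p)) (l : ℕ) (h : l ≤ p) :
    Fin l → V :=
  fun i => v (σ (Fin.castLE h i))

/-- `(v_{σ(l+1)}, …, v_{σ(p)})`. -/
def lastArgs {V : Type*} {p : ℕ} (v : Fin p → V) (σ : Equiv.Perm (Fin p)) (l : ℕ) :
    Fin (p - l) → V :=
  fun i => v (σ ⟨l + i.val, by omega⟩)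

/-- `(x, w₂, …, w_m)`: the entry `w₁` is replaced by `x`. -/
def replaceFirst {V : Type*} {m : ℕ} (x : V) (w : Fin m → V) : Fin m → V :=
  fun i => if i.val = 0 then x else w i

/-- `(x, v₁, …, v̂ᵢ, …, v̂ⱼ, …, v_p)` for `i < j`. -/
def hatArgs {V : Type*} {p : ℕ} (x : V) (v : Fin p → V) (i j : Fin p) : Fin (p - 1) → V :=
  replaceFirst x fun m => v (hatIndex i j m)

/-- `(w₁, …, w_m, x)`. -/
def appendLast {V : Type*} {m : ℕ} (w : Fin m → V) (x : V) : Fin (m + 1) → V :=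
  Fin.snoc (α := fun _ => V) w x

/-- `vᵢ(v₁ + ⋯ + v_{i-1}) + vⱼ(v₁ + ⋯ + v_{j-1}) + vᵢ vⱼ`, for elements of degrees `d`. -/
def pairExponent {p : ℕ} (d : Fin p → ℤ) (i j : Fin p) : ℤ :=
  d i * (∑ a ∈ Finset.univ.filter (· < i), d a) +
    d j * (∑ a ∈ Finset.univ.filter (· < j), d a) + d i * d j

end Combinatorics

section GradedSymmetric

variable {K : Type*} [Field K] {V : Type*} [AddCommGroup V] [Module K V]

open scoped TensorProduct

/-- The relations `v₁ ⊗ ⋯ ⊗ vₙ = ε(σ) v_{σ(1)} ⊗ ⋯ ⊗ v_{σ(n)}` for homogeneous `vᵢ`. -/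
def symRelations (𝒱 : ℤ → Submodule K V) (n : ℕ) : Submodule K (⨂[K] _ : Fin n, V) :=
  Submodule.span K {t | ∃ (d : Fin n → ℤ) (v : Fin n → V) (σ : Equiv.Perm (Fin n)),
    (∀ i, v i ∈ 𝒱 (d i)) ∧
    t = PiTensorProduct.tprod K v
      - koszulSign K d σ • PiTensorProduct.tprod K (fun i => v (σ i))}

/-- The graded symmetric power `Sⁿ(V)` of the graded vector space `V = ⊕ 𝒱 i`. -/
abbrev SymPower (𝒱 : ℤ → Submodule K V) (n : ℕ) : Type _ :=
  (⨂[K] _ : Fin n, V) ⧸ symRelations 𝒱 n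

/-- `S(V) = ⊕ₙ Sⁿ(V)`. -/
abbrev SymAlg (𝒱 : ℤ → Submodule K V) : Type _ :=
  DirectSum ℕ fun n => SymPower 𝒱 n

/-- `(v₁, …, vₙ) ↦ v₁ ⊙ ⋯ ⊙ vₙ` as a multilinear map into `S(V)`. -/
noncomputable def symProd (𝒱 : ℤ → Submodule K V) (n : ℕ) :
    MultilinearMap K (fun _ : Fin n => V) (SymAlg 𝒱) :=
  ((DirectSum.lof K ℕ (fun n => SymPower 𝒱 n) n) ∘ₗ
    (symRelations 𝒱 n).mkQ).compMultilinearMap (PiTensorProduct.tprod K)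

variable {W : Type*} [AddCommGroup W] [Module K W]

/-- The component `Tₙ` of `T = ∑ Tₙ : S(V) → W`, as a multilinear map `(v₁, …, vₙ) ↦ Tₙ(v₁, …, vₙ)`. -/
noncomputable def component {𝒱 : ℤ → Submodule K V} (T : SymAlg 𝒱 →ₗ[K] W) (n : ℕ) :
    MultilinearMap K (fun _ : Fin n => V) W :=
  T.compMultilinearMap (symProd 𝒱 n)

/-- A multilinear map is of degree `m`. -/
def MultilinearHasDegree (𝒱 : ℤ → Submodule K V) (𝒲 : ℤ → Submodule K W) (m : ℤ) {n : ℕ}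
    (f : MultilinearMap K (fun _ : Fin n => V) W) : Prop :=
  ∀ (d : Fin n → ℤ) (v : Fin n → V), (∀ i, v i ∈ 𝒱 (d i)) → f v ∈ 𝒲 ((∑ i, d i) + m)

/-- `T ∈ Hom^m(S(V), W)`: the degree of `v₁ ⊙ ⋯ ⊙ vₙ` is the sum of the degrees of the `vᵢ`. -/
def HasDegree (𝒱 : ℤ → Submodule K V) (𝒲 : ℤ → Submodule K W) (m : ℤ)
    (T : SymAlg 𝒱 →ₗ[K] W) : Prop :=
  ∀ n : ℕ, MultilinearHasDegree 𝒱 𝒲 m (component T n)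

end GradedSymmetric

section SymmetricGradedLie

variable {K : Type*} [Field K]
variable {G : Type*} [AddCommGroup G] [Module K G]
variable {H : Type*} [AddCommGroup H] [Module K H]

/-- A symmetric graded Lie algebra structure (bracket of degree `1`) on the graded vector space
`⊕ 𝒢 i`. -/
structure SymGradedLie (𝒢 : ℤ → Submodule K G) where
  bracket : G →ₗ[K] G →ₗ[K] G
  bracket_mem : ∀ (i j : ℤ) (x y : G), x ∈ 𝒢 i → y ∈ 𝒢 j → bracket x y ∈ 𝒢 (i + j + 1)
  bracket_symm : ∀ (i j : ℤ) (x y : G), x ∈ 𝒢 i → y ∈ 𝒢 j →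
    bracket x y = (-1 : K) ^ (i * j) • bracket y x
  leibniz : ∀ (i j k : ℤ) (x y z : G), x ∈ 𝒢 i → y ∈ 𝒢 j → z ∈ 𝒢 k →
    bracket x (bracket y z) = (-1 : K) ^ (i + 1) • bracket (bracket x y) z
      + (-1 : K) ^ ((i + 1) * (j + 1)) • bracket y (bracket x z)

/-- `D ∈ Derⁿ(𝔥)`: `D` is a derivation of degree `n` of a symmetric graded Lie algebra. -/
structure IsDerivation {ℋ : ℤ → Submodule K H} (LH : SymGradedLie ℋ) (n : ℤ)
    (D : Module.End K H) : Prop where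
  map_mem : ∀ (i : ℤ) (x : H), x ∈ ℋ i → D x ∈ ℋ (i + n)
  map_bracket : ∀ (i j : ℤ) (x y : H), x ∈ ℋ i → y ∈ ℋ j →
    D (LH.bracket x y) = (-1 : K) ^ n • LH.bracket (D x) y
      + (-1 : K) ^ (n * (i + 1)) • LH.bracket x (D y)

/-- The graded commutator `[f, g] = f g - (-1)^{mn} g f` of endomorphisms of degrees `m`, `n`. -/
def gradedCommutator (m n : ℤ) (f g : Module.End K H) : Module.End K H :=
  f * g - (-1 : K) ^ (m * n) • (g * f)

/-- The bracket of `s⁻¹ Der(𝔥)` and `s⁻¹ gl(𝔥)`, `[s⁻¹ f, s⁻¹ g] = (-1)^m s⁻¹ [f, g]` for `f`, `g` of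
degrees `m`, `n` before desuspension; `s⁻¹` is the identity on underlying vector spaces. -/
def desuspendedBracket (m n : ℤ) (f g : Module.End K H) : Module.End K H :=
  (-1 : K) ^ m • gradedCommutator m n f g

/-- An action of a symmetric graded Lie algebra on another one: a degree `1` map `ρ : 𝔤 → Der(𝔥)` such
that `s⁻¹ ∘ ρ : 𝔤 → s⁻¹ Der(𝔥)` preserves brackets. -/
structure LieAction {𝒢 : ℤ → Submodule K G} {ℋ : ℤ → Submodule K H}
    (LG : SymGradedLie 𝒢) (LH : SymGradedLie ℋ) where
  rho : G →ₗ[K] Module.End K H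
  rho_mem : ∀ (i : ℤ) (x : G), x ∈ 𝒢 i → IsDerivation LH (i + 1) (rho x)
  rho_bracket : ∀ (i j : ℤ) (x y : G), x ∈ 𝒢 i → y ∈ 𝒢 j →
    rho (LG.bracket x y) = desuspendedBracket (i + 1) (j + 1) (rho x) (rho y)

/-- A homotopy `O`-operator of weight `lam` on `𝔤` with respect to the action `ρ` on `𝔥`: an element
`T = ∑ Tᵢ` of `Hom⁰(S(𝔥), 𝔤)` subject to the generalized Rota-Baxter identities. In the second sum
`k - 1 = p - l`; in the third one the number `k - 1` is called `l` and the other is `p - l`. -/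
structure IsHomotopyOOperator {𝒢 : ℤ → Submodule K G} {ℋ : ℤ → Submodule K H}
    {LG : SymGradedLie 𝒢} {LH : SymGradedLie ℋ} (ρ : LieAction LG LH) (lam : K)
    (T : SymAlg ℋ →ₗ[K] G) : Prop where
  degree_zero : HasDegree ℋ 𝒢 0 T
  identity : ∀ (p : ℕ) (d : Fin p → ℤ) (v : Fin p → H), (∀ i, v i ∈ ℋ (d i)) →
    (∑ q ∈ orderedPairs p, (-1 : K) ^ pairExponent d q.1 q.2 •
        component T (p - 1) (hatArgs (lam • LH.bracket (v q.1) (v q.2)) v q.1 q.2))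
    + (∑ l : Fin p, ∑ σ ∈ shuffles₃ p l, koszulSign K d σ •
        component T (p - l) (replaceFirst
          (ρ.rho (component T l (firstArgs v σ l l.isLt.le)) (v (σ l)))
          (lastArgs v σ l)))
    = (1 / 2 : K) • ∑ l : Fin (p + 1), ∑ σ ∈ shuffles₂ p l, koszulSign K d σ •
        LG.bracket (component T l (firstArgs v σ l (Nat.le_of_lt_succ l.isLt)))
          (component T (p - l) (lastArgs v σ l))

/-- An operator homotopy post-Lie algebra structure on a symmetric graded Lie algebra. The operation
`θ_k`, `k ≥ 1`, is `θ (k - 1)`, so that `θ p` has `p` graded symmetric arguments and a last one. In the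
relation, `p = n - 1`, the last element `v_n` is `y`, and the numbers `i - 1`, `j - 1` of the first sum are
`l`, `p - l`, those of the second sum are `p - l`, `l`. -/
structure IsOperatorHomotopyPostLie {ℋ : ℤ → Submodule K H} (LH : SymGradedLie ℋ)
    (θ : (p : ℕ) → MultilinearMap K (fun _ : Fin (p + 1) => H) H) : Prop where
  degree_one : ∀ p : ℕ, MultilinearHasDegree ℋ ℋ 1 (θ p)
  graded_symm : ∀ (p : ℕ) (d : Fin p → ℤ) (x : Fin p → H) (e : ℤ) (y : H),
    (∀ i, x i ∈ ℋ (d i)) → y ∈ ℋ e → ∀ σ : Equiv.Perm (Fin p),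
    θ p (appendLast (fun i => x (σ i)) y) = koszulSign K d σ • θ p (appendLast x y)
  graded_derivation : ∀ (p : ℕ) (d : Fin p → ℤ) (x : Fin p → H) (e f : ℤ) (y z : H),
    (∀ i, x i ∈ ℋ (d i)) → y ∈ ℋ e → z ∈ ℋ f →
    θ p (appendLast x (LH.bracket y z))
      = (-1 : K) ^ ((∑ i, d i) + 1) • LH.bracket (θ p (appendLast x y)) z
        + (-1 : K) ^ (((∑ i, d i) + 1) * (e + 1)) • LH.bracket y (θ p (appendLast x z))
  relation : ∀ (p : ℕ) (d : Fin p → ℤ) (v : Fin p → H) (e : ℤ) (y : H),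
    (∀ i, v i ∈ ℋ (d i)) → y ∈ ℋ e →
    (∑ l : Fin p, ∑ σ ∈ shuffles₃ p l, koszulSign K d σ •
        θ (p - l) (appendLast
          (replaceFirst (θ l (appendLast (firstArgs v σ l l.isLt.le) (v (σ l)))) (lastArgs v σ l))
          y))
    + (∑ l : Fin (p + 1), ∑ σ ∈ shuffles₂ p l,
        ((-1 : K) ^ (∑ a, firstArgs d σ l (Nat.le_of_lt_succ l.isLt) a) * koszulSign K d σ) •
          θ l (appendLast (firstArgs v σ l (Nat.le_of_lt_succ l.isLt))
            (θ (p - l) (appendLast (lastArgs v σ l) y))))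
    = ∑ q ∈ orderedPairs p, (-1 : K) ^ (pairExponent d q.1 q.2 + 1) •
        θ (p - 1) (appendLast (hatArgs (LH.bracket (v q.1) (v q.2)) v q.1 q.2) y)

end SymmetricGradedLie

end HomotopyPostLie

/-! Evaluating `ρ` of the `O`-operator identity on `y` turns it into the post-Lie relation. The
left-hand sums become the terms with `[v_i, v_j]` and the terms with a nested first argument. On the
right, the action axiom expands `ρ([T_l, T_{p-l}]) y` into two compositions of operators, one in
each order. Exchanging the two blocks of a shuffle carries one family of compositions to the other,
and the resulting Koszul sign is exactly the commutator sign (`koszulSign_mul_blockSwap`). The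
families thus have equal sums, and the factor `1/2` disappears (`half_sum_rho_bracket`). The other
axioms are inherited: graded symmetry because `T` is defined on `S(𝔥)`, the derivation rule because
`ρ` takes values in derivations. -/

namespace HomotopyPostLie

/-! ### Parity of signs -/

section Signs

variable {K : Type*} [Field K]

theorem neg_one_zpow_mul_self (n : ℤ) : (-1 : K) ^ n * (-1 : K) ^ n = 1 := by
  rw [← mul_zpow]; simp

theorem neg_one_zpow_congr {m n k : ℤ} (h : m = n + 2 * k) : (-1 : K) ^ m = (-1 : K) ^ n := by
  rw [h, zpow_add₀ (by simp), zpow_mul]; simp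

theorem prod_neg_one_zpow {ι : Type*} (s : Finset ι) (f : ι → ℤ) :
    ∏ i ∈ s, (-1 : K) ^ f i = (-1 : K) ^ ∑ i ∈ s, f i := by
  classical
  induction s using Finset.induction_on with
  | empty => simp
  | insert a s ha ih =>
    rw [Finset.prod_insert ha, Finset.sum_insert ha, ih, zpow_add₀ (by simp)]

theorem koszulSign_mul_self {n : ℕ} (d : Fin n → ℤ) (σ : Equiv.Perm (Fin n)) :
    koszulSign K d σ * koszulSign K d σ = 1 := by
  simp only [koszulSign, ← Finset.prod_mul_distrib]
  refine Finset.prod_eq_one fun i _ => Finset.prod_eq_one fun j _ => ?_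
  split_ifs
  · exact neg_one_zpow_mul_self _
  · simp

end Signs

/-! ### Exchanging the two blocks of a shuffle -/

section BlockSwap

/-- The permutation `(1, …, p) ↦ (l + 1, …, p, 1, …, l)` exchanging the block of the first `l` letters
and the block of the other `p - l` letters. -/
def blockSwap (p l : ℕ) (h : l ≤ p) : Equiv.Perm (Fin p) where
  toFun i := if hi : i.val < p - l then ⟨l + i.val, by omega⟩ else ⟨i.val - (p - l), by omega⟩
  invFun i := if hi : i.val < l then ⟨i.val + (p - l), by omega⟩ else ⟨i.val - l, by omega⟩
  left_inv i := by
    by_cases hi : i.val < p - l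
    · have h' : ¬ l + i.val < l := by omega
      simp [hi, h']
    · have h' : i.val - (p - l) < l := by omega
      simp only [hi, h', dite_true, dite_false, Fin.ext_iff]
      omega
  right_inv i := by
    by_cases hi : i.val < l
    · have h' : ¬ i.val + (p - l) < p - l := by omega
      simp [hi, h']
    · have h' : i.val - l < p - l := by omega
      simp only [hi, h', dite_true, dite_false, Fin.ext_iff]
      omega

theorem blockSwap_val (p l : ℕ) (h : l ≤ p) (i : Fin p) :
    (blockSwap p l h i).val = if i.val < p - l then l + i.val else i.val - (p - l) := by
  change (dite _ _ _ : Fin p).val = _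
  split_ifs <;> rfl

theorem blockSwap_symm_val (p l : ℕ) (h : l ≤ p) (i : Fin p) :
    ((blockSwap p l h).symm i).val = if i.val < l then i.val + (p - l) else i.val - l := by
  change (dite _ _ _ : Fin p).val = _
  split_ifs <;> rfl

/-- A shuffle is a permutation increasing on each block, and the exchange maps blocks to blocks
increasingly. -/
theorem mul_blockSwap_mem_shuffles₂ {p l : ℕ} (h : l ≤ p) (σ : Equiv.Perm (Fin p)) :
    σ * blockSwap p l h ∈ shuffles₂ p (p - l) ↔ σ ∈ shuffles₂ p l := by
  simp only [shuffles₂, Finset.mem_filter, Finset.mem_univ, true_and, Equiv.Perm.mul_apply]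
  constructor
  · intro H i j hij hl
    have := H ((blockSwap p l h).symm i) ((blockSwap p l h).symm j)
    simp only [Equiv.apply_symm_apply, Fin.lt_def, blockSwap_symm_val] at this
    rw [Fin.lt_def] at hij ⊢
    refine this ?_ ?_ <;> split_ifs <;> omega
  · intro H i j hij hl
    refine H _ _ ?_ ?_ <;> simp only [Fin.lt_def, blockSwap_val] at hij ⊢ <;> split_ifs <;> omega

theorem sum_shuffles₂_blockSwap {M : Type*} [AddCommMonoid M] {p : ℕ}
    (F G : Fin (p + 1) → Equiv.Perm (Fin p) → M)
    (h : ∀ (l : Fin (p + 1)), ∀ σ ∈ shuffles₂ p l,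
      F l σ = G l.rev (σ * blockSwap p l (Nat.le_of_lt_succ l.isLt))) :
    ∑ l : Fin (p + 1), ∑ σ ∈ shuffles₂ p l, F l σ =
      ∑ l : Fin (p + 1), ∑ σ ∈ shuffles₂ p l, G l σ := by
  refine Fintype.sum_equiv Fin.revPerm _ _ fun l => ?_
  refine Finset.sum_equiv (Equiv.mulRight (blockSwap p l (Nat.le_of_lt_succ l.isLt)))
    (fun σ => ?_) (fun σ hσ => h l σ hσ)
  have hl : (Fin.revPerm l).val = p - l.val := by simp [Fin.val_rev]
  rw [hl]
  exact (mul_blockSwap_mem_shuffles₂ (Nat.le_of_lt_succ l.isLt) σ).symm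

theorem sum_firstArgs {M : Type*} [AddCommMonoid M] {p l : ℕ} (h : l ≤ p) (d : Fin p → M)
    (σ : Equiv.Perm (Fin p)) :
    ∑ i, firstArgs d σ l h i = ∑ i : Fin p, if i.val < l then d (σ i) else 0 := by
  obtain ⟨k, rfl⟩ := Nat.exists_eq_add_of_le h
  simp [Fin.sum_univ_add, firstArgs]
  rfl

theorem sum_lastArgs {M : Type*} [AddCommMonoid M] {p l : ℕ} (h : l ≤ p) (d : Fin p → M)
    (σ : Equiv.Perm (Fin p)) :
    ∑ i, lastArgs d σ l i = ∑ i : Fin p, if l ≤ i.val then d (σ i) else 0 := by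
  obtain ⟨k, rfl⟩ := Nat.exists_eq_add_of_le h
  have hk : ∀ i : Fin l, ¬ l ≤ i.val := fun i => by omega
  simp only [Fin.sum_univ_add, Fin.val_castAdd, hk, Fin.val_natAdd, Nat.le_add_right, if_true,
    if_false, Finset.sum_const_zero, zero_add]
  exact Fintype.sum_equiv (finCongr (Nat.add_sub_cancel_left l k)) _ _ fun i => rfl

/-- Since `σ` increases on each block, only pairs with one letter in each block can be inverted, and
each such pair is inverted by exactly one of `σ` and `σ * blockSwap`. The product of the two Koszul
signs therefore runs over all cross pairs, which gives the product of the block degrees. -/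
theorem koszulSign_mul_blockSwap (K : Type*) [Field K] {p l : ℕ} (h : l ≤ p) (d : Fin p → ℤ)
    {σ : Equiv.Perm (Fin p)} (hσ : σ ∈ shuffles₂ p l) :
    koszulSign K d (σ * blockSwap p l h) = koszulSign K d σ *
      (-1 : K) ^ ((∑ i, firstArgs d σ l h i) * ∑ i, lastArgs d σ l i) := by
  have key : koszulSign K d σ * koszulSign K d (σ * blockSwap p l h) =
      (-1 : K) ^ ((∑ i, firstArgs d σ l h i) * ∑ i, lastArgs d σ l i) := by
    -- The factors are indexed by positions for `σ`, with the roles of `i` and `j` interchanged, so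
    -- that in both signs a cross pair has `i` in the first block.
    have h₁ : koszulSign K d (σ * blockSwap p l h) = ∏ i : Fin p, ∏ j : Fin p,
        if (blockSwap p l h).symm j < (blockSwap p l h).symm i ∧ σ i < σ j then
          (-1 : K) ^ (d (σ i) * d (σ j)) else 1 := by
      rw [koszulSign, Finset.prod_comm]
      refine Fintype.prod_equiv (blockSwap p l h) _ _ fun j => ?_
      refine Fintype.prod_equiv (blockSwap p l h) _ _ fun i => ?_
      simp [mul_comm]
    rw [h₁, koszulSign, sum_firstArgs, sum_lastArgs h, Finset.sum_mul_sum, ← prod_neg_one_zpow,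
      ← Finset.prod_mul_distrib]
    refine Finset.prod_congr rfl fun i _ => ?_
    rw [← prod_neg_one_zpow, ← Finset.prod_mul_distrib]
    refine Finset.prod_congr rfl fun j _ => ?_
    simp only [shuffles₂, Finset.mem_filter, Finset.mem_univ, true_and] at hσ
    have hij := hσ i j
    have hji := hσ j i
    have hne : σ i = σ j → i = j := fun e => σ.injective e
    simp only [Fin.lt_def, Fin.ext_iff, blockSwap_symm_val] at hij hji hne ⊢
    split_ifs <;> first
      | (exfalso; omega)
      | simp
  rw [← key, ← mul_assoc, koszulSign_mul_self, one_mul]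

/-- The length `m` is kept apart from `p - l` because it will be the value of `l.rev`, equal to `p -
l` only propositionally. -/
theorem firstArgs_mul_blockSwap {V : Type*} {p l m : ℕ} (h : l ≤ p) (hm : m = p - l) (hmp : m ≤ p)
    (v : Fin p → V) (σ : Equiv.Perm (Fin p)) (i : Fin m) :
    firstArgs v (σ * blockSwap p l h) m hmp i = lastArgs v σ l (Fin.cast hm i) := by
  refine congrArg (fun k => v (σ k)) (Fin.ext ?_)
  simp only [blockSwap_val, Fin.val_castLE, Fin.val_cast]
  rw [if_pos (by omega)]

theorem lastArgs_mul_blockSwap {V : Type*} {p l m : ℕ} (h : l ≤ p) (hm : m = p - l)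
    (v : Fin p → V) (σ : Equiv.Perm (Fin p)) (i : Fin (p - m)) :
    lastArgs v (σ * blockSwap p l h) m i = firstArgs v σ l h (Fin.cast (by omega) i) := by
  refine congrArg (fun k => v (σ k)) (Fin.ext ?_)
  simp only [blockSwap_val, Fin.val_castLE, Fin.val_cast]
  rw [if_neg (by omega)]
  omega

end BlockSwap

/-! ### The operations induced by `ρ` and `T` -/

section Operations

variable {K : Type*} [Field K]
variable {G : Type*} [AddCommGroup G] [Module K G] {𝒢 : ℤ → Submodule K G}
variable {H : Type*} [AddCommGroup H] [Module K H] {ℋ : ℤ → Submodule K H}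
variable {LG : SymGradedLie 𝒢} {LH : SymGradedLie ℋ}

theorem component_congr (T : SymAlg ℋ →ₗ[K] G) {m n : ℕ} (h : m = n) {v : Fin m → H} {w : Fin n → H}
    (hvw : ∀ i, v i = w (Fin.cast h i)) : component T m v = component T n w := by
  subst h
  exact congrArg _ (funext hvw)

theorem component_perm (T : SymAlg ℋ →ₗ[K] G) {p : ℕ} {d : Fin p → ℤ} {v : Fin p → H}
    (hv : ∀ i, v i ∈ ℋ (d i)) (σ : Equiv.Perm (Fin p)) :
    component T p (fun i => v (σ i)) = koszulSign K d σ • component T p v := by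
  have h : (symRelations ℋ p).mkQ (PiTensorProduct.tprod K v) =
      koszulSign K d σ • (symRelations ℋ p).mkQ (PiTensorProduct.tprod K fun i => v (σ i)) := by
    rw [← map_smul, ← sub_eq_zero, ← map_sub, Submodule.mkQ_apply, Submodule.Quotient.mk_eq_zero]
    exact Submodule.subset_span ⟨d, v, σ, hv, rfl⟩
  -- The defining relation of `S(𝔥)` carries the sign on the permuted side; it moves across because
  -- it squares to one.
  have h' : component T p v = koszulSign K d σ • component T p (fun i => v (σ i)) := by
    simp only [component, symProd, LinearMap.compMultilinearMap_apply, LinearMap.comp_apply]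
    rw [h, map_smul, map_smul]
  rw [h', smul_smul, koszulSign_mul_self, one_smul]

/-- The operation `(v₁, …, v_p, y) ↦ ρ(T_p(v₁, …, v_p)) y`. -/
noncomputable def operation (ρ : LieAction LG LH) (T : SymAlg ℋ →ₗ[K] G) (p : ℕ) :
    MultilinearMap K (fun _ : Fin (p + 1) => H) H :=
  MultilinearMap.uncurryRight (M := fun _ : Fin (p + 1) => H)
    (ρ.rho.compMultilinearMap (component T p))

theorem operation_appendLast (ρ : LieAction LG LH) (T : SymAlg ℋ →ₗ[K] G) (p : ℕ) (v : Fin p → H)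
    (y : H) : operation ρ T p (appendLast v y) = ρ.rho (component T p v) y := by
  simp [operation, appendLast]

theorem component_mem {T : SymAlg ℋ →ₗ[K] G} (hT : HasDegree ℋ 𝒢 0 T) {p : ℕ} {d : Fin p → ℤ}
    {v : Fin p → H} (hv : ∀ i, v i ∈ ℋ (d i)) : component T p v ∈ 𝒢 (∑ i, d i) := by
  simpa using hT p d v hv

/-- The action on brackets `[a, b]`, split into two terms exchanged with each other by `a ↔ b`. -/
theorem rho_bracket_apply (ρ : LieAction LG LH) {i j : ℤ} {a b : G} (ha : a ∈ 𝒢 i) (hb : b ∈ 𝒢 j)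
    (y : H) : ρ.rho (LG.bracket a b) y =
      -((-1 : K) ^ i • ρ.rho a (ρ.rho b y)) -
        ((-1 : K) ^ (i * j) * (-1 : K) ^ j) • ρ.rho b (ρ.rho a y) := by
  have h₁ : (-1 : K) ^ (i + 1) = -(-1 : K) ^ i := by rw [zpow_add₀ (by simp)]; simp
  -- This form isolates `(-1)^j`, the coefficient of the first term after `a ↔ b`, from the Koszul
  -- sign `(-1)^(i * j)` of the exchange.
  have h₂ : (-1 : K) ^ (i + 1) * (-1 : K) ^ ((i + 1) * (j + 1)) =
      (-1 : K) ^ (i * j) * (-1 : K) ^ j := by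
    rw [← zpow_add₀ (by simp), ← zpow_add₀ (by simp)]
    exact neg_one_zpow_congr (k := i + 1) (by ring)
  rw [ρ.rho_bracket i j a b ha hb, desuspendedBracket, gradedCommutator, smul_sub, smul_smul, h₂, h₁]
  simp

/-- The two halves of the sum of the brackets `[T_l, T_{p-l}]` contribute equally to the action. -/
theorem half_sum_rho_bracket [CharZero K] (ρ : LieAction LG LH) {T : SymAlg ℋ →ₗ[K] G}
    (hT : HasDegree ℋ 𝒢 0 T) {p : ℕ} {d : Fin p → ℤ} {v : Fin p → H} (hv : ∀ i, v i ∈ ℋ (d i))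
    (y : H) :
    (1 / 2 : K) • ∑ l : Fin (p + 1), ∑ σ ∈ shuffles₂ p l, koszulSign K d σ •
        ρ.rho (LG.bracket (component T l (firstArgs v σ l (Nat.le_of_lt_succ l.isLt)))
          (component T (p - l) (lastArgs v σ l))) y =
      -∑ l : Fin (p + 1), ∑ σ ∈ shuffles₂ p l,
        ((-1 : K) ^ (∑ a, firstArgs d σ l (Nat.le_of_lt_succ l.isLt) a) * koszulSign K d σ) •
          ρ.rho (component T l (firstArgs v σ l (Nat.le_of_lt_succ l.isLt)))
            (ρ.rho (component T (p - l) (lastArgs v σ l)) y) := by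
  let F : Fin (p + 1) → Equiv.Perm (Fin p) → H := fun l σ =>
    ((-1 : K) ^ (∑ a, firstArgs d σ l (Nat.le_of_lt_succ l.isLt) a) * koszulSign K d σ) •
      ρ.rho (component T l (firstArgs v σ l (Nat.le_of_lt_succ l.isLt)))
        (ρ.rho (component T (p - l) (lastArgs v σ l)) y)
  -- The opposite-order terms: the factor with the product of block degrees is the sign by which the
  -- block exchange changes `koszulSign`, so `F'` is `F` reindexed.
  let F' : Fin (p + 1) → Equiv.Perm (Fin p) → H := fun l σ =>
    (koszulSign K d σ * ((-1 : K) ^ ((∑ a, firstArgs d σ l (Nat.le_of_lt_succ l.isLt) a) *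
        ∑ a, lastArgs d σ l a) * (-1 : K) ^ (∑ a, lastArgs d σ l a))) •
      ρ.rho (component T (p - l) (lastArgs v σ l))
        (ρ.rho (component T l (firstArgs v σ l (Nat.le_of_lt_succ l.isLt))) y)
  have hswap : ∑ l : Fin (p + 1), ∑ σ ∈ shuffles₂ p l, F' l σ =
      ∑ l : Fin (p + 1), ∑ σ ∈ shuffles₂ p l, F l σ := by
    refine sum_shuffles₂_blockSwap F' F fun l σ hσ => ?_
    have hl : l.val ≤ p := Nat.le_of_lt_succ l.isLt
    have hr : l.rev.val = p - l.val := by rw [Fin.val_rev]; omega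
    have hsum : ∑ a, firstArgs d (σ * blockSwap p l hl) l.rev (Nat.le_of_lt_succ l.rev.isLt) a =
        ∑ a, lastArgs d σ l a :=
      Fintype.sum_equiv (finCongr hr) _ _ fun i => firstArgs_mul_blockSwap hl hr _ d σ i
    simp only [F, F']
    rw [hsum, koszulSign_mul_blockSwap K hl d hσ,
      component_congr T hr (firstArgs_mul_blockSwap hl hr _ v σ),
      component_congr T (by omega) (lastArgs_mul_blockSwap hl hr v σ)]
    congr 1
    ring
  have hsplit : ∑ l : Fin (p + 1), ∑ σ ∈ shuffles₂ p l, koszulSign K d σ •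
        ρ.rho (LG.bracket (component T l (firstArgs v σ l (Nat.le_of_lt_succ l.isLt)))
          (component T (p - l) (lastArgs v σ l))) y =
      -(∑ l : Fin (p + 1), ∑ σ ∈ shuffles₂ p l, F l σ) -
        ∑ l : Fin (p + 1), ∑ σ ∈ shuffles₂ p l, F' l σ := by
    simp only [← Finset.sum_neg_distrib, ← Finset.sum_sub_distrib]
    refine Finset.sum_congr rfl fun l _ => Finset.sum_congr rfl fun σ _ => ?_
    rw [rho_bracket_apply ρ
      (component_mem hT (v := firstArgs v σ l (Nat.le_of_lt_succ l.isLt))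
        (d := firstArgs d σ l (Nat.le_of_lt_succ l.isLt)) fun i => hv _)
      (component_mem hT (v := lastArgs v σ l) (d := lastArgs d σ l) fun i => hv _)]
    simp only [F, F', smul_sub, smul_neg, smul_smul, mul_comm]
  -- Both halves are now the same sum; characteristic zero cancels `1/2` against `2`.
  rw [hsplit, hswap, ← neg_add', ← two_smul K, smul_neg, smul_smul]
  norm_num [F]

theorem operation_isOperatorHomotopyPostLie [CharZero K] (ρ : LieAction LG LH)
    {T : SymAlg ℋ →ₗ[K] G} (hT : IsHomotopyOOperator ρ 1 T) :
    IsOperatorHomotopyPostLie LH (operation ρ T) where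
  degree_one p d v hv := by
    have hsnoc : v = appendLast (Fin.init v) (v (Fin.last p)) := (Fin.snoc_init_self v).symm
    have hmem := (ρ.rho_mem _ _ (component_mem hT.degree_zero (v := Fin.init v)
      (fun i : Fin p => hv i.castSucc))).map_mem _ _ (hv (Fin.last p))
    rw [hsnoc, operation_appendLast, Fin.sum_univ_castSucc]
    convert hmem using 1
    rw [add_assoc, add_left_comm]
  graded_symm p d x e y hx _ σ := by
    rw [operation_appendLast, operation_appendLast, component_perm T hx σ, map_smul,
      LinearMap.smul_apply]
  graded_derivation p d x e f y z hx hy hz := by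
    simp only [operation_appendLast]
    exact (ρ.rho_mem _ _ (component_mem hT.degree_zero hx)).map_bracket e f y z hy hz
  relation p d v e y hv _ := by
    have h := congrArg (fun g => ρ.rho g y) (hT.identity p d v hv)
    simp only [map_add, map_sum, map_smul, LinearMap.add_apply, LinearMap.sum_apply,
      LinearMap.smul_apply, one_smul] at h
    rw [half_sum_rho_bracket ρ hT.degree_zero hv y] at h
    simp only [operation_appendLast, zpow_add₀ (neg_ne_zero.mpr (one_ne_zero' K)), zpow_one,
      mul_neg, mul_one, neg_smul, Finset.sum_neg_distrib]
    -- With `A` the bracket terms, `B` the nested terms and `C` the compositions, `h` reads `A + B =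
    -- -C` and the goal `B + C = -A`.
    rw [← sub_eq_zero] at h ⊢
    rw [← h]
    abel

end Operations

end HomotopyPostLie

theorem mainTheorem6 {K : Type*} [Field K] [CharZero K]
    {G : Type*} [AddCommGroup G] [Module K G] (𝒢 : ℤ → Submodule K G) [DirectSum.Decomposition 𝒢]
    {H : Type*} [AddCommGroup H] [Module K H] (ℋ : ℤ → Submodule K H) [DirectSum.Decomposition ℋ]
    (LG : HomotopyPostLie.SymGradedLie 𝒢) (LH : HomotopyPostLie.SymGradedLie ℋ)
    (ρ : HomotopyPostLie.LieAction LG LH)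
    (T : HomotopyPostLie.SymAlg ℋ →ₗ[K] G)
    (hT : HomotopyPostLie.IsHomotopyOOperator ρ 1 T) :
    ∃ θ : (p : ℕ) → MultilinearMap K (fun _ : Fin (p + 1) => H) H,
      (∀ (p : ℕ) (v : Fin p → H) (y : H),
        θ p (HomotopyPostLie.appendLast v y)
          = ρ.rho (HomotopyPostLie.component T p v) y) ∧
      HomotopyPostLie.IsOperatorHomotopyPostLie LH θ := by
  exact ⟨HomotopyPostLie.operation ρ T, HomotopyPostLie.operation_appendLast ρ T,
    HomotopyPostLie.operation_isOperatorHomotopyPostLie ρ hT⟩
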